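/- Let $b,c,d$ be smooth real functions on $[0,2]$ and $\beta,\gamma$ real numbers with $b\ge\beta^2>0$ and $c-\tfrac12\|d\|_{L^\infty(1,2)}-\tfrac{1}{2\beta^2}\|b'\|_{L^\infty(0,2)}^2\ge\gamma>0$ on $[0,2]$. Then there is a constant $C>0$, depending only on $b,c,d,\beta,\gamma$, such that the following holds for every $\varepsilon>0$, all $f\in L^\infty(0,2)$ and $\Phi\in L^\infty(-1,0)$, and all real $\alpha_1,\alpha_2,\alpha_3,\beta_1,\beta_2,\beta_3,\delta_1,\delta_2$. Let $u_1\in W^{4,1}(0,1)$ and $u_2\in W^{4,1}(1,2)$ (that is, $u_i$ is $C^3$ up to the end points with $u_i'''$ absolutely continuous) satisfy, almost everywhere on the respective interval, $$\varepsilon^2u_1^{(4)}(x)-b(x)u_1''(x)+c(x)u_1(x)=f(x)-d(x)\Phi(x-1),\quad x\in(0,1),$$ $$\varepsilon^2u_2^{(4)}(x)-b(x)u_2''(x)+c(x)u_2(x)=f(x)-d(x)u_1(x-1),\quad x\in(1,2),$$ together with $$u_1(0)=\alpha_1,\quad u_1(1)=\alpha_2,\quad u_2(1)=\alpha_2+\delta_1,\quad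 u_2(2)=\alpha_3,$$ $$u_1'(0)=\beta_1,\quad u_1'(1)=\beta_2,\quad u_2'(1)=\beta_2+\delta_2,\quad u_2'(2)=\beta_3,$$ where $\alpha_2,\beta_2$ are such that $u_2''(1)=u_1''(1)$ and $u_2'''(1)=u_1'''(1)$ (one-sided derivatives). Then $u:=u_1\chi_{[0,1)}+u_2\chi_{[1,2]}$ belongs to $L^\infty(0,2)$ and $$\|u\|_{L^\infty(0,2)}\le C\left(\|f\|_{L^\infty(0,2)}+\|\Phi\|_{L^\infty(-1,0)} +|\alpha_1|+|\alpha_3|+|\delta_1|+|\delta_2|+|\beta_1|+|\beta_3|\right).$$ -/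

import Mathlib

open MeasureTheory Set
open scoped ENNReal ContDiff

/-- The norm of `L^∞(D)` with respect to Lebesgue measure (the essential supremum of `|g|`),
to be used for functions in `L^∞(D)`. -/
noncomputable def linftyNorm (D : Set ℝ) (g : ℝ → ℝ) : ℝ :=
  (eLpNorm g ∞ (volume.restrict D)).toReal

/-- `g ∈ L^∞(D)`. -/
def MemLinfty (D : Set ℝ) (g : ℝ → ℝ) : Prop :=
  MemLp g ∞ (volume.restrict D)

/-- The `k`-th derivative of a function on the closed interval `[l, r]`
(one-sided at the end points). -/
noncomputable def dOn (l r : ℝ) (k : ℕ) (v : ℝ → ℝ) : ℝ → ℝ :=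
  iteratedDerivWithin k v (Icc l r)

/-- The regularity of a strong (Carathéodory) solution of a 4th order equation on `[l, r]`:
`v` is three times continuously differentiable up to the end points and `v'''` is absolutely
continuous, i.e. `v ∈ W^{4,1}(l, r)`. The fourth derivative then exists almost everywhere. -/
def IsStrong4 (l r : ℝ) (v : ℝ → ℝ) : Prop :=
  ContDiffOn ℝ 3 v (Icc l r) ∧ AbsolutelyContinuousOnInterval (dOn l r 3 v) l r

/-- The standing assumptions on the coefficients: `b, c, d` are smooth on `[0, 2]`,
`b ≥ β² > 0` and `c - ‖d‖_{L^∞(1,2)} / 2 - ‖b'‖²_{L^∞(0,2)} / (2 β²) ≥ γ > 0`. -/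
structure CoeffAssumptions (b c d : ℝ → ℝ) (β γ : ℝ) : Prop where
  smooth_b : ContDiffOn ℝ ∞ b (Icc 0 2)
  smooth_c : ContDiffOn ℝ ∞ c (Icc 0 2)
  smooth_d : ContDiffOn ℝ ∞ d (Icc 0 2)
  beta_pos : 0 < β ^ 2
  le_b : ∀ x ∈ Icc (0 : ℝ) 2, β ^ 2 ≤ b x
  gamma_pos : 0 < γ
  le_c : ∀ x ∈ Icc (0 : ℝ) 2,
    γ ≤ c x - linftyNorm (Ioo 1 2) d / 2
      - linftyNorm (Ioo 0 2) (deriv b) ^ 2 / (2 * β ^ 2)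

/-- The split system: the 4th order equations on `(0,1)` (with the history `Φ` in the shift term)
and on `(1,2)` (with `u₁` in the shift term). -/
structure SplitSystem (ε : ℝ) (b c d f Φ u₁ u₂ : ℝ → ℝ) : Prop where
  reg₁ : IsStrong4 0 1 u₁
  reg₂ : IsStrong4 1 2 u₂
  eq₁ : ∀ᵐ x ∂(volume.restrict (Ioo (0 : ℝ) 1)),
    ε ^ 2 * dOn 0 1 4 u₁ x - b x * dOn 0 1 2 u₁ x + c x * u₁ x = f x - d x * Φ (x - 1)
  eq₂ : ∀ᵐ x ∂(volume.restrict (Ioo (1 : ℝ) 2)),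
    ε ^ 2 * dOn 1 2 4 u₂ x - b x * dOn 1 2 2 u₂ x + c x * u₂ x = f x - d x * u₁ (x - 1)

/-- The general conditions at `0`, `1` and `2`: Dirichlet data for values and first derivatives,
with jumps `δ₁`, `δ₂` of the value and of the first derivative at `1`. -/
structure GeneralConditions (α₁ α₂ α₃ β₁ β₂ β₃ δ₁ δ₂ : ℝ) (u₁ u₂ : ℝ → ℝ) : Prop where
  val₀ : u₁ 0 = α₁
  val₁_left : u₁ 1 = α₂
  val₁_right : u₂ 1 = α₂ + δ₁
  val₂ : u₂ 2 = α₃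
  der₀ : dOn 0 1 1 u₁ 0 = β₁
  der₁_left : dOn 0 1 1 u₁ 1 = β₂
  der₁_right : dOn 1 2 1 u₂ 1 = β₂ + δ₂
  der₂ : dOn 1 2 1 u₂ 2 = β₃

/-- The jump at `1` of the `k`-th derivative, `u₂^{(k)}(1⁺) - u₁^{(k)}(1⁻)`. -/
noncomputable def jumpAtOne (k : ℕ) (u₁ u₂ : ℝ → ℝ) : ℝ :=
  dOn 1 2 k u₂ 1 - dOn 0 1 k u₁ 1

/-- The function `u = u₁ χ_{[0,1)} + u₂ χ_{[1,2]}`. -/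
noncomputable def glue (u₁ u₂ : ℝ → ℝ) : ℝ → ℝ :=
  (Ico (0 : ℝ) 1).indicator u₁ + (Icc (1 : ℝ) 2).indicator u₂

/-!
Subtract from `(u₁, u₂)` an affine and a quintic function that realise the boundary data and the
jumps. The remainder `(w₁, w₂)` is clamped at `0` and `2` and has no jumps at `1`, so testing both
equations with it makes the boundary terms at `1` cancel. The term `b' w' w` is absorbed by half of
`b w'²` and by `c`, while the shift term `d w₁(x - 1) w₂` costs `‖d‖ / 2` in front of `w₂²` on
`(1, 2)` and, after translation, of `w₁²` on `(0, 1)`; this is what the assumption on `c` pays for.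
What is left of the energy controls `(s / 2 + ε²) ‖w‖²` in the sup norm, since `w` and `w'` vanish
at an end point of an interval of length one. The residual of the lift contributes at most
`(1 + ε²)` times the data, and `(1 + ε²) / (s / 2 + ε²)` is bounded in `ε`.
-/

section Linfty

variable {D D' : Set ℝ} {g : ℝ → ℝ}

theorem linftyNorm_nonneg : 0 ≤ linftyNorm D g := ENNReal.toReal_nonneg

theorem MemLinfty.ae_abs_le (hg : MemLinfty D g) :
    ∀ᵐ x ∂(volume.restrict D), |g x| ≤ linftyNorm D g := by
  simpa only [linftyNorm, toReal_eLpNorm hg.1, Real.norm_eq_abs] using ae_le_lpNorm_exponent_top hg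

theorem MemLinfty.mono (hg : MemLinfty D g) (h : D' ⊆ D) : MemLinfty D' g :=
  MemLp.mono_measure (Measure.restrict_mono h le_rfl) hg

theorem linftyNorm_le_of_bound {M : ℝ} (hD : MeasurableSet D) (hM₀ : 0 ≤ M)
    (hM : ∀ x ∈ D, |g x| ≤ M) : linftyNorm D g ≤ M := by
  refine ENNReal.toReal_le_of_le_ofReal hM₀ ?_
  rw [eLpNorm_exponent_top]
  exact eLpNormEssSup_le_of_ae_bound ((ae_restrict_iff' hD).2 (ae_of_all _ hM))

theorem memLinfty_Icc_of_continuousOn {l r : ℝ} (hg : ContinuousOn g (Icc l r)) :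
    MemLinfty (Icc l r) g := by
  obtain ⟨M, hM⟩ := isCompact_Icc.exists_bound_of_continuousOn hg
  exact memLp_top_of_bound (hg.aestronglyMeasurable measurableSet_Icc) M
    ((ae_restrict_iff' measurableSet_Icc).2 (ae_of_all _ hM))

theorem memLinfty_deriv_of_contDiffOn {l r : ℝ} (hlr : l < r) (hg : ContDiffOn ℝ 1 g (Icc l r)) :
    MemLinfty (Ioo l r) (deriv g) := by
  have h := (memLinfty_Icc_of_continuousOn
    (hg.continuousOn_derivWithin (uniqueDiffOn_Icc hlr) le_rfl)).mono Ioo_subset_Icc_self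
  refine (memLp_congr_ae ?_).1 h
  filter_upwards [ae_restrict_mem measurableSet_Ioo] with x hx
  exact derivWithin_of_mem_nhds (Icc_mem_nhds hx.1 hx.2)

theorem ae_restrict_Ioo_comp_sub_right {p : ℝ → Prop} {l r : ℝ} (t : ℝ)
    (h : ∀ᵐ x ∂(volume.restrict (Ioo l r)), p x) :
    ∀ᵐ x ∂(volume.restrict (Ioo (l + t) (r + t))), p (x - t) := by
  rw [ae_restrict_iff' measurableSet_Ioo] at h ⊢
  filter_upwards [(measurePreserving_sub_right volume t).quasiMeasurePreserving.ae h] with x hx hxI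
  exact hx ⟨by linarith [hxI.1], by linarith [hxI.2]⟩

variable {u₁ u₂ : ℝ → ℝ}

theorem abs_glue_le {M x : ℝ} (h₁ : ∀ x ∈ Icc (0 : ℝ) 1, |u₁ x| ≤ M)
    (h₂ : ∀ x ∈ Icc (1 : ℝ) 2, |u₂ x| ≤ M) (hx : x ∈ Icc (0 : ℝ) 2) : |glue u₁ u₂ x| ≤ M := by
  rcases lt_or_ge x 1 with hx1 | hx1
  · simpa [glue, hx.1, hx1] using h₁ x ⟨hx.1, hx1.le⟩
  · simpa [glue, hx.2, hx1] using h₂ x ⟨hx1, hx.2⟩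

theorem memLinfty_glue (h₁ : ContinuousOn u₁ (Icc 0 1)) (h₂ : ContinuousOn u₂ (Icc 1 2)) :
    MemLinfty D (glue u₁ u₂) := by
  have hl : MemLp ((Ico (0 : ℝ) 1).indicator u₁) ∞ volume :=
    (memLp_indicator_iff_restrict measurableSet_Ico).2
      ((memLinfty_Icc_of_continuousOn h₁).mono Ico_subset_Icc_self)
  have hr : MemLp ((Icc (1 : ℝ) 2).indicator u₂) ∞ volume :=
    (memLp_indicator_iff_restrict measurableSet_Icc).2 (memLinfty_Icc_of_continuousOn h₂)
  exact (hl.add hr).restrict D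

end Linfty

section Calculus

variable {l r : ℝ}

theorem absolutelyContinuousOnInterval_of_eqOn {f g : ℝ → ℝ}
    (hf : AbsolutelyContinuousOnInterval f l r) (hfg : EqOn f g (uIcc l r)) :
    AbsolutelyContinuousOnInterval g l r := by
  rw [absolutelyContinuousOnInterval_iff] at hf ⊢
  intro ε hε
  obtain ⟨δ, hδ, h⟩ := hf ε hε
  refine ⟨δ, hδ, fun E hE hlen ↦ lt_of_eq_of_lt (Finset.sum_congr rfl fun i hi ↦ ?_) (h E hE hlen)⟩
  rw [hfg (hE.1 i hi).1, hfg (hE.1 i hi).2]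

theorem sub_le_integral_of_ae_hasDerivAt_le {P P' h : ℝ → ℝ} (hlr : l ≤ r)
    (hP : AbsolutelyContinuousOnInterval P l r) (hh : ContinuousOn h (Icc l r))
    (hP' : ∀ᵐ x ∂(volume.restrict (Ioo l r)), HasDerivAt P (P' x) x)
    (hle : ∀ᵐ x ∂(volume.restrict (Ioo l r)), P' x ≤ h x) :
    P r - P l ≤ ∫ x in l..r, h x := by
  rw [← hP.integral_deriv_eq_sub]
  refine intervalIntegral.integral_mono_ae_restrict hlr hP.intervalIntegrable_deriv
    (hh.intervalIntegrable_of_Icc hlr) ?_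
  rw [← restrict_Ioo_eq_restrict_Icc]
  filter_upwards [hP', hle] with x hx hx'
  rwa [hx.deriv]

theorem sq_intervalIntegral_le {h : ℝ → ℝ} (hlr : l < r) (hh : ContinuousOn h (Icc l r)) :
    (∫ x in l..r, h x) ^ 2 ≤ (r - l) * ∫ x in l..r, h x ^ 2 := by
  have hL : 0 < r - l := sub_pos.2 hlr
  have hint : IntervalIntegrable h volume l r := hh.intervalIntegrable_of_Icc hlr.le
  have hsq : IntervalIntegrable (fun x ↦ h x ^ 2) volume l r :=
    (hh.pow 2).intervalIntegrable_of_Icc hlr.le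
  set T := ∫ x in l..r, h x with hT
  have hvar : 0 ≤ ∫ x in l..r, ((r - l) * h x - T) ^ 2 :=
    intervalIntegral.integral_nonneg hlr.le fun x _ ↦ sq_nonneg _
  have hexpand : ∫ x in l..r, ((r - l) * h x - T) ^ 2 =
      (r - l) * ((r - l) * (∫ x in l..r, h x ^ 2) - T ^ 2) := by
    have : ∀ x, ((r - l) * h x - T) ^ 2 =
        (r - l) ^ 2 * h x ^ 2 - 2 * (r - l) * T * h x + T ^ 2 := fun x ↦ by ring
    simp only [this]
    rw [intervalIntegral.integral_add ((hsq.const_mul _).sub (hint.const_mul _))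
      intervalIntegrable_const, intervalIntegral.integral_sub (hsq.const_mul _)
      (hint.const_mul _), intervalIntegral.integral_const_mul,
      intervalIntegral.integral_const_mul, intervalIntegral.integral_const, ← hT, smul_eq_mul]
    ring
  rw [hexpand] at hvar
  exact sub_nonneg.1 (nonneg_of_mul_nonneg_right hvar hL)

theorem sq_le_mul_integral_sq_of_eq_zero {v v' : ℝ → ℝ} {a x : ℝ} (hlr : l < r)
    (hv : ContinuousOn v (Icc l r)) (hv' : ContinuousOn v' (Icc l r))
    (hd : ∀ y ∈ Ioo l r, HasDerivAt v (v' y) y) (ha : a ∈ Icc l r) (hva : v a = 0)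
    (hx : x ∈ Icc l r) : v x ^ 2 ≤ (r - l) * ∫ y in l..r, v' y ^ 2 := by
  have hsub : uIcc a x ⊆ Icc l r := uIcc_subset_Icc ha hx
  have hftc : ∫ y in a..x, v' y = v x := by
    rw [intervalIntegral.integral_eq_sub_of_hasDeriv_right (hv.mono hsub)
      (fun y hy ↦ (hd y ⟨(le_min ha.1 hx.1).trans_lt hy.1,
        hy.2.trans_le (max_le ha.2 hx.2)⟩).hasDerivWithinAt)
      (hv'.mono hsub).intervalIntegrable, hva, sub_zero]
  have habs : |v x| ≤ ∫ y in l..r, |v' y| := by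
    calc |v x| = |∫ y in a..x, v' y| := by rw [hftc]
      _ ≤ |(∫ y in a..x, |v' y|)| := by
        simpa only [Real.norm_eq_abs] using
          intervalIntegral.norm_integral_le_abs_integral_norm (f := v') (μ := volume)
      _ ≤ |(∫ y in l..r, |v' y|)| := by
        refine intervalIntegral.abs_integral_mono_interval ?_
          (ae_of_all _ fun y ↦ abs_nonneg _) (hv'.abs.intervalIntegrable_of_Icc hlr.le)
        rw [uIoc_of_le hlr.le]
        exact Ioc_subset_Ioc (le_min ha.1 hx.1) (max_le ha.2 hx.2)
      _ = ∫ y in l..r, |v' y| :=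
        abs_of_nonneg (intervalIntegral.integral_nonneg hlr.le fun y _ ↦ abs_nonneg _)
  calc v x ^ 2 = |v x| ^ 2 := (sq_abs _).symm
    _ ≤ (∫ y in l..r, |v' y|) ^ 2 := by gcongr
    _ ≤ (r - l) * ∫ y in l..r, |v' y| ^ 2 := sq_intervalIntegral_le hlr hv'.abs
    _ = (r - l) * ∫ y in l..r, v' y ^ 2 := by simp only [sq_abs]

end Calculus

section Strong4

variable {l r : ℝ} {u v : ℝ → ℝ}

@[simp]
theorem dOn_zero : dOn l r 0 v = v := iteratedDerivWithin_zero

theorem dOn_succ (k : ℕ) : dOn l r (k + 1) v = derivWithin (dOn l r k v) (Icc l r) :=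
  iteratedDerivWithin_succ

theorem isStrong4_of_contDiffOn (hlr : l < r) (hv : ContDiffOn ℝ 4 v (Icc l r)) :
    IsStrong4 l r v := by
  obtain ⟨h₃, h₁⟩ := (contDiffOn_nat_succ_iff_contDiffOn_one_iteratedDerivWithin (n := 3)
    (uniqueDiffOn_Icc hlr)).1 hv
  refine ⟨h₃, ContDiffOn.absolutelyContinuousOnInterval ?_⟩
  rw [uIcc_of_le hlr.le]
  exact h₁

namespace IsStrong4

theorem contDiffOn_dOn (hv : IsStrong4 l r v) (hlr : l < r) {k : ℕ} (hk : k < 3) :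
    ContDiffOn ℝ 1 (dOn l r k v) (Icc l r) :=
  ((contDiffOn_nat_succ_iff_contDiffOn_one_iteratedDerivWithin (uniqueDiffOn_Icc hlr)).1
    (hv.1.of_le (by exact_mod_cast hk))).2

theorem absolutelyContinuousOnInterval_dOn (hv : IsStrong4 l r v) (hlr : l < r) {k : ℕ}
    (hk : k ≤ 3) : AbsolutelyContinuousOnInterval (dOn l r k v) l r := by
  rcases hk.lt_or_eq with hk | rfl
  · refine ContDiffOn.absolutelyContinuousOnInterval ?_
    rw [uIcc_of_le hlr.le]
    exact hv.contDiffOn_dOn hlr hk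
  · exact hv.2

theorem continuousOn_dOn (hv : IsStrong4 l r v) (hlr : l < r) {k : ℕ} (hk : k ≤ 3) :
    ContinuousOn (dOn l r k v) (Icc l r) := by
  simpa only [uIcc_of_le hlr.le] using (hv.absolutelyContinuousOnInterval_dOn hlr hk).continuousOn

theorem hasDerivAt_dOn (hv : IsStrong4 l r v) (hlr : l < r) {k : ℕ} (hk : k < 3)
    {x : ℝ} (hx : x ∈ Ioo l r) : HasDerivAt (dOn l r k v) (dOn l r (k + 1) v x) x := by
  rw [dOn_succ]
  exact ((hv.contDiffOn_dOn hlr hk).differentiableOn one_ne_zero x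
    (Ioo_subset_Icc_self hx)).hasDerivWithinAt.hasDerivAt (Icc_mem_nhds hx.1 hx.2)

theorem ae_hasDerivAt_dOn_three (hv : IsStrong4 l r v) :
    ∀ᵐ x ∂(volume.restrict (Ioo l r)), HasDerivAt (dOn l r 3 v) (dOn l r 4 v x) x := by
  rw [ae_restrict_iff' measurableSet_Ioo]
  filter_upwards [hv.2.ae_differentiableAt] with x hx hxI
  rw [dOn_succ 3, derivWithin_of_mem_nhds (Icc_mem_nhds hxI.1 hxI.2)]
  exact (hx (Icc_subset_uIcc (Ioo_subset_Icc_self hxI))).hasDerivAt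

theorem dOn_sub (hu : IsStrong4 l r u) (hv : IsStrong4 l r v) (hlr : l < r) {k : ℕ} (hk : k ≤ 3)
    {x : ℝ} (hx : x ∈ Icc l r) : dOn l r k (u - v) x = dOn l r k u x - dOn l r k v x :=
  iteratedDerivWithin_sub hx (uniqueDiffOn_Icc hlr)
    ((hu.1 x hx).of_le (by exact_mod_cast hk)) ((hv.1 x hx).of_le (by exact_mod_cast hk))

theorem ae_dOn_four_sub (hu : IsStrong4 l r u) (hv : IsStrong4 l r v) (hlr : l < r) :
    ∀ᵐ x ∂(volume.restrict (Ioo l r)), dOn l r 4 (u - v) x = dOn l r 4 u x - dOn l r 4 v x := by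
  filter_upwards [hu.ae_hasDerivAt_dOn_three, hv.ae_hasDerivAt_dOn_three,
    ae_restrict_mem measurableSet_Ioo] with x hux hvx hx
  have hxI := Ioo_subset_Icc_self hx
  rw [dOn_succ 3 (v := u - v), derivWithin_congr (fun y hy ↦ hu.dOn_sub hv hlr le_rfl hy)
    (hu.dOn_sub hv hlr le_rfl hxI)]
  exact (hux.sub hvx).hasDerivWithinAt.derivWithin (uniqueDiffOn_Icc hlr x hxI)

theorem sub (hu : IsStrong4 l r u) (hv : IsStrong4 l r v) (hlr : l < r) :
    IsStrong4 l r (u - v) := by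
  refine ⟨hu.1.sub hv.1, absolutelyContinuousOnInterval_of_eqOn (hu.2.sub hv.2) fun x hx ↦ ?_⟩
  rw [uIcc_of_le hlr.le] at hx
  exact (hu.dOn_sub hv hlr le_rfl hx).symm

end IsStrong4

end Strong4

section Energy

/-- The differential operator `ε² v'''' - b v'' + c v` on `[l, r]`. -/
noncomputable def fourthOrderOp (ε l r : ℝ) (b c v : ℝ → ℝ) : ℝ → ℝ :=
  fun x ↦ ε ^ 2 * dOn l r 4 v x - b x * dOn l r 2 v x + c x * v x

/-- The boundary term `ε² (w''' w - w'' w') - b w' w` that partial integration of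
`(ε² w'''' - b w'') w` over `[l, r]` leaves at the end points. -/
noncomputable def energyFlux (ε l r : ℝ) (b w : ℝ → ℝ) : ℝ → ℝ :=
  fun x ↦ ε ^ 2 * (dOn l r 3 w x * w x - dOn l r 2 w x * dOn l r 1 w x) -
    b x * (dOn l r 1 w x * w x)

/-- The part of the energy `ε² ‖w''‖² + s ‖w'‖²` in `L²(l, r)` that is left after half of the
first-order term has been spent on absorbing `b' w' w`. -/
noncomputable def energy (ε s l r : ℝ) (w : ℝ → ℝ) : ℝ :=
  s / 2 * (∫ x in l..r, dOn l r 1 w x ^ 2) + ε ^ 2 * ∫ x in l..r, dOn l r 2 w x ^ 2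

theorem mul_le_mul_of_abs_le {x y N m : ℝ} (hx : |x| ≤ N) (hy : |y| ≤ m) : x * y ≤ N * m :=
  (le_abs_self _).trans <| (abs_mul x y).trans_le <|
    mul_le_mul hx hy (abs_nonneg y) ((abs_nonneg x).trans hx)

theorem neg_mul_mul_le_half_mul_sq_add_sq {k x y D : ℝ} (hk : |k| ≤ D) :
    -(k * (x * y)) ≤ D / 2 * x ^ 2 + D / 2 * y ^ 2 := by
  have hxy : |x * y| ≤ (x ^ 2 + y ^ 2) / 2 := by
    rw [abs_le]
    constructor <;> linarith [sq_nonneg (x + y), sq_nonneg (x - y)]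
  linarith [mul_le_mul_of_abs_le ((abs_neg k).trans_le hk) hxy]

theorem neg_mul_mul_le_of_abs_le {k x y B s : ℝ} (hs : 0 < s) (hk : |k| ≤ B) :
    -(k * (x * y)) ≤ s / 2 * x ^ 2 + B ^ 2 / (2 * s) * y ^ 2 := by
  have hkB : k ^ 2 / (2 * s) * y ^ 2 ≤ B ^ 2 / (2 * s) * y ^ 2 := by
    have := sq_le_sq' (neg_le_of_abs_le hk) (le_of_abs_le hk)
    gcongr
  have hsq : s / 2 * x ^ 2 + k * (x * y) + k ^ 2 / (2 * s) * y ^ 2 =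
      s / 2 * (x + k / s * y) ^ 2 := by
    field_simp
    ring
  have : 0 ≤ s / 2 * (x + k / s * y) ^ 2 := by positivity
  linarith

variable {ε s l r : ℝ} {b u v w : ℝ → ℝ}

theorem energy_nonneg (hs : 0 ≤ s) (hlr : l ≤ r) : 0 ≤ energy ε s l r w := by
  have h₁ : 0 ≤ ∫ x in l..r, dOn l r 1 w x ^ 2 :=
    intervalIntegral.integral_nonneg hlr fun x _ ↦ sq_nonneg _
  have h₂ : 0 ≤ ∫ x in l..r, dOn l r 2 w x ^ 2 :=
    intervalIntegral.integral_nonneg hlr fun x _ ↦ sq_nonneg _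
  unfold energy
  positivity

theorem abs_fourthOrderOp_le {c : ℝ → ℝ} {Nb Nc M x : ℝ} (hb : |b x| ≤ Nb) (hc : |c x| ≤ Nc)
    (hv : ∀ k ≤ 4, |dOn l r k v x| ≤ M) :
    |fourthOrderOp ε l r b c v x| ≤ (1 + ε ^ 2) * ((1 + Nb + Nc) * M) := by
  have hNb : 0 ≤ Nb := (abs_nonneg _).trans hb
  have hNc : 0 ≤ Nc := (abs_nonneg _).trans hc
  have hM : 0 ≤ M := (abs_nonneg _).trans (hv 0 (by norm_num))
  have h₀ : |c x * v x| ≤ Nc * M := by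
    have := hv 0 (by norm_num)
    rw [dOn_zero] at this
    rw [abs_mul]
    gcongr
  have h₂ : |b x * dOn l r 2 v x| ≤ Nb * M := by
    have := hv 2 (by norm_num)
    rw [abs_mul]
    gcongr
  have h₄ : |ε ^ 2 * dOn l r 4 v x| ≤ ε ^ 2 * M := by
    have := hv 4 le_rfl
    rw [abs_mul, abs_sq]
    gcongr
  calc |fourthOrderOp ε l r b c v x| ≤ ε ^ 2 * M + Nb * M + Nc * M :=
        (abs_add_le _ _).trans (add_le_add ((abs_sub _ _).trans (add_le_add h₄ h₂)) h₀)
    _ ≤ ε ^ 2 * M + Nb * M + Nc * M + (M + ε ^ 2 * ((Nb + Nc) * M)) :=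
        le_add_of_nonneg_right (by positivity)
    _ = (1 + ε ^ 2) * ((1 + Nb + Nc) * M) := by ring

namespace IsStrong4

theorem ae_fourthOrderOp_sub (c : ℝ → ℝ) (hu : IsStrong4 l r u) (hv : IsStrong4 l r v)
    (hlr : l < r) :
    ∀ᵐ x ∂(volume.restrict (Ioo l r)), fourthOrderOp ε l r b c (u - v) x =
      fourthOrderOp ε l r b c u x - fourthOrderOp ε l r b c v x := by
  filter_upwards [hu.ae_dOn_four_sub hv hlr, ae_restrict_mem measurableSet_Ioo] with x h₄ hx
  simp only [fourthOrderOp, h₄, hu.dOn_sub hv hlr (by norm_num : 2 ≤ 3) (Ioo_subset_Icc_self hx),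
    Pi.sub_apply]
  ring

theorem absolutelyContinuousOnInterval_energyFlux (hw : IsStrong4 l r w) (hlr : l < r)
    (hb : AbsolutelyContinuousOnInterval b l r) :
    AbsolutelyContinuousOnInterval (energyFlux ε l r b w) l r := by
  have h₀ : AbsolutelyContinuousOnInterval w l r :=
    hw.absolutelyContinuousOnInterval_dOn hlr (k := 0) (by norm_num)
  have h₁ := hw.absolutelyContinuousOnInterval_dOn hlr (k := 1) (by norm_num)
  have h₂ := hw.absolutelyContinuousOnInterval_dOn hlr (k := 2) (by norm_num)
  exact (((hw.2.fun_mul h₀).fun_sub (h₂.fun_mul h₁)).const_mul (ε ^ 2)).fun_sub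
    (hb.fun_mul (h₁.fun_mul h₀))

theorem ae_hasDerivAt_energyFlux (c : ℝ → ℝ) (hw : IsStrong4 l r w) (hlr : l < r)
    (hb : AbsolutelyContinuousOnInterval b l r) :
    ∀ᵐ x ∂(volume.restrict (Ioo l r)), HasDerivAt (energyFlux ε l r b w)
      (fourthOrderOp ε l r b c w x * w x - c x * w x ^ 2 - b x * dOn l r 1 w x ^ 2
        - deriv b x * (dOn l r 1 w x * w x) - ε ^ 2 * dOn l r 2 w x ^ 2) x := by
  filter_upwards [hw.ae_hasDerivAt_dOn_three, ae_restrict_of_ae hb.ae_differentiableAt,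
    ae_restrict_mem measurableSet_Ioo] with x h₃ hbx hx
  have h₀ : HasDerivAt w (dOn l r 1 w x) x := hw.hasDerivAt_dOn hlr (k := 0) (by norm_num) hx
  have h₁ := hw.hasDerivAt_dOn hlr (k := 1) (by norm_num) hx
  have h₂ := hw.hasDerivAt_dOn hlr (k := 2) (by norm_num) hx
  have hb' := (hbx (Icc_subset_uIcc (Ioo_subset_Icc_self hx))).hasDerivAt
  convert! (((h₃.mul h₀).sub (h₂.mul h₁)).const_mul (ε ^ 2)).sub (hb'.mul (h₁.mul h₀)) using 1
  simp only [fourthOrderOp, Pi.mul_apply]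
  ring

theorem energyFlux_sub_add_energy_le {c h : ℝ → ℝ} {B : ℝ} (hw : IsStrong4 l r w) (hlr : l < r)
    (hb : AbsolutelyContinuousOnInterval b l r) (hs : 0 < s) (hsb : ∀ x ∈ Icc l r, s ≤ b x)
    (hB : ∀ᵐ x ∂(volume.restrict (Ioo l r)), |deriv b x| ≤ B) (hh : ContinuousOn h (Icc l r))
    (hop : ∀ᵐ x ∂(volume.restrict (Ioo l r)),
      fourthOrderOp ε l r b c w x * w x ≤ (c x - B ^ 2 / (2 * s)) * w x ^ 2 + h x) :
    energyFlux ε l r b w r - energyFlux ε l r b w l + energy ε s l r w ≤ ∫ x in l..r, h x := by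
  have hc₁ : ContinuousOn (fun x ↦ dOn l r 1 w x ^ 2) (Icc l r) :=
    (hw.continuousOn_dOn hlr (by norm_num)).pow 2
  have hc₂ : ContinuousOn (fun x ↦ dOn l r 2 w x ^ 2) (Icc l r) :=
    (hw.continuousOn_dOn hlr (by norm_num)).pow 2
  have hflux : energyFlux ε l r b w r - energyFlux ε l r b w l ≤
      ∫ x in l..r, (h x - (s / 2 * dOn l r 1 w x ^ 2 + ε ^ 2 * dOn l r 2 w x ^ 2)) := by
    refine sub_le_integral_of_ae_hasDerivAt_le hlr.le
      (hw.absolutelyContinuousOnInterval_energyFlux hlr hb)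
      (hh.sub ((continuousOn_const.mul hc₁).add (continuousOn_const.mul hc₂)))
      (hw.ae_hasDerivAt_energyFlux c hlr hb) ?_
    filter_upwards [hB, hop, ae_restrict_mem measurableSet_Ioo] with x hBx hopx hx
    have hyoung := neg_mul_mul_le_of_abs_le (x := dOn l r 1 w x) (y := w x) hs hBx
    have helliptic : s * dOn l r 1 w x ^ 2 ≤ b x * dOn l r 1 w x ^ 2 := by
      have := hsb x (Ioo_subset_Icc_self hx)
      gcongr
    linarith
  have hi₁ := (hc₁.intervalIntegrable_of_Icc (μ := volume) hlr.le).const_mul (s / 2)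
  have hi₂ := (hc₂.intervalIntegrable_of_Icc (μ := volume) hlr.le).const_mul (ε ^ 2)
  rw [intervalIntegral.integral_sub (hh.intervalIntegrable_of_Icc hlr.le) (hi₁.add hi₂),
    intervalIntegral.integral_add hi₁ hi₂, intervalIntegral.integral_const_mul,
    intervalIntegral.integral_const_mul] at hflux
  unfold energy
  linarith

theorem mul_sq_le_energy {a x : ℝ} (hw : IsStrong4 l r w) (hlr : l < r) (hunit : r - l ≤ 1)
    (hs : 0 ≤ s) (ha : a ∈ Icc l r) (h₀ : w a = 0) (h₁ : dOn l r 1 w a = 0) (hx : x ∈ Icc l r) :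
    (s / 2 + ε ^ 2) * w x ^ 2 ≤ energy ε s l r w := by
  have hpoincare : ∀ k < 2, dOn l r k w a = 0 → ∀ y ∈ Icc l r,
      dOn l r k w y ^ 2 ≤ ∫ z in l..r, dOn l r (k + 1) w z ^ 2 := fun k hk hka y hy ↦
    (sq_le_mul_integral_sq_of_eq_zero hlr (hw.continuousOn_dOn hlr (by lia))
      (hw.continuousOn_dOn hlr (by lia)) (fun z hz ↦ hw.hasDerivAt_dOn hlr (by lia) hz)
      ha hka hy).trans (mul_le_of_le_one_left
        (intervalIntegral.integral_nonneg hlr.le fun z _ ↦ sq_nonneg _) hunit)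
  have hw₁ : w x ^ 2 ≤ ∫ z in l..r, dOn l r 1 w z ^ 2 := hpoincare 0 (by norm_num) h₀ x hx
  have h₁₂ : ∫ z in l..r, dOn l r 1 w z ^ 2 ≤ ∫ z in l..r, dOn l r 2 w z ^ 2 := by
    have hmono := intervalIntegral.integral_mono_on (μ := volume) hlr.le
      (((hw.continuousOn_dOn hlr (by norm_num)).pow 2).intervalIntegrable_of_Icc hlr.le)
      intervalIntegrable_const (hpoincare 1 (by norm_num) h₁)
    rw [intervalIntegral.integral_const, smul_eq_mul] at hmono
    exact hmono.trans (mul_le_of_le_one_left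
      (intervalIntegral.integral_nonneg hlr.le fun z _ ↦ sq_nonneg _) hunit)
  calc (s / 2 + ε ^ 2) * w x ^ 2 = s / 2 * w x ^ 2 + ε ^ 2 * w x ^ 2 := add_mul _ _ _
    _ ≤ energy ε s l r w := by
      unfold energy
      gcongr
      exact hw₁.trans h₁₂

end IsStrong4

end Energy

section ClampedPair

/-- `CoeffAssumptions` for `b ∈ W^{1,∞}(0, 2)` and `c, d ∈ L^∞(0, 2)`, with `s` in place of `β²`
and with `γ = 0`: what the energy estimate needs of the coefficients. -/
structure WeakCoeffAssumptions (b c d : ℝ → ℝ) (s : ℝ) : Prop where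
  absolutelyContinuous_b : AbsolutelyContinuousOnInterval b 0 2
  memLinfty_deriv_b : MemLinfty (Ioo 0 2) (deriv b)
  memLinfty_c : MemLinfty (Ioo 0 2) c
  memLinfty_d : MemLinfty (Ioo 0 2) d
  pos : 0 < s
  le_b : ∀ x ∈ Icc (0 : ℝ) 2, s ≤ b x
  le_c : ∀ᵐ x ∂(volume.restrict (Ioo (0 : ℝ) 2)),
    linftyNorm (Ioo 1 2) d / 2 + linftyNorm (Ioo 0 2) (deriv b) ^ 2 / (2 * s) ≤ c x

theorem CoeffAssumptions.weak {b c d : ℝ → ℝ} {β γ : ℝ} (h : CoeffAssumptions b c d β γ) :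
    WeakCoeffAssumptions b c d (β ^ 2) where
  absolutelyContinuous_b := ContDiffOn.absolutelyContinuousOnInterval <| by
    rw [uIcc_of_le zero_le_two]
    exact h.smooth_b.of_le (by exact_mod_cast le_top)
  memLinfty_deriv_b :=
    memLinfty_deriv_of_contDiffOn two_pos (h.smooth_b.of_le (by exact_mod_cast le_top))
  memLinfty_c := (memLinfty_Icc_of_continuousOn h.smooth_c.continuousOn).mono Ioo_subset_Icc_self
  memLinfty_d := (memLinfty_Icc_of_continuousOn h.smooth_d.continuousOn).mono Ioo_subset_Icc_self
  pos := h.beta_pos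
  le_b := h.le_b
  le_c := (ae_restrict_iff' measurableSet_Ioo).2 <| ae_of_all _ fun x hx ↦ by
    linarith [h.le_c x (Ioo_subset_Icc_self hx), h.gamma_pos]

theorem WeakCoeffAssumptions.energyFlux_sub_add_energy_le {b c d h w : ℝ → ℝ} {ε s l r : ℝ}
    (hcoeff : WeakCoeffAssumptions b c d s) (hw : IsStrong4 l r w) (hlr : l < r) (hl : 0 ≤ l)
    (hr : r ≤ 2) (hh : ContinuousOn h (Icc l r))
    (hop : ∀ᵐ x ∂(volume.restrict (Ioo l r)), fourthOrderOp ε l r b c w x * w x ≤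
      linftyNorm (Ioo 1 2) d / 2 * w x ^ 2 + h x) :
    energyFlux ε l r b w r - energyFlux ε l r b w l + energy ε s l r w ≤ ∫ x in l..r, h x := by
  have hIcc : Icc l r ⊆ Icc 0 2 := Icc_subset_Icc hl hr
  have hIoo : Ioo l r ⊆ Ioo 0 2 := Ioo_subset_Ioo hl hr
  refine hw.energyFlux_sub_add_energy_le (c := c) (B := linftyNorm (Ioo 0 2) (deriv b)) hlr
    (hcoeff.absolutelyContinuous_b.mono ?_) hcoeff.pos (fun x hx ↦ hcoeff.le_b x (hIcc hx))
    (ae_restrict_of_ae_restrict_of_subset hIoo hcoeff.memLinfty_deriv_b.ae_abs_le) hh ?_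
  · rwa [uIcc_of_le hlr.le, uIcc_of_le zero_le_two]
  · filter_upwards [hop, ae_restrict_of_ae_restrict_of_subset hIoo hcoeff.le_c] with x hopx hcx
    have := mul_le_mul_of_nonneg_right (le_sub_iff_add_le.2 hcx) (sq_nonneg (w x))
    linarith

/-- A pair of strong functions on `[0, 1]` and `[1, 2]` that is clamped (value and slope vanish) at
`0` and `2` and whose derivatives up to the third one do not jump at `1`. Differences of functions
subject to the same `GeneralConditions` are of this kind, and can serve as test functions. -/
structure ClampedPair (w₁ w₂ : ℝ → ℝ) : Prop where
  reg₁ : IsStrong4 0 1 w₁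
  reg₂ : IsStrong4 1 2 w₂
  val₀ : w₁ 0 = 0
  der₀ : dOn 0 1 1 w₁ 0 = 0
  val₂ : w₂ 2 = 0
  der₂ : dOn 1 2 1 w₂ 2 = 0
  jump : ∀ k ≤ 3, jumpAtOne k w₁ w₂ = 0

theorem jumpAtOne_sub {u₁ u₂ v₁ v₂ : ℝ → ℝ} (hu₁ : IsStrong4 0 1 u₁) (hu₂ : IsStrong4 1 2 u₂)
    (hv₁ : IsStrong4 0 1 v₁) (hv₂ : IsStrong4 1 2 v₂) {k : ℕ} (hk : k ≤ 3) :
    jumpAtOne k (u₁ - v₁) (u₂ - v₂) = jumpAtOne k u₁ u₂ - jumpAtOne k v₁ v₂ := by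
  rw [jumpAtOne, hu₁.dOn_sub hv₁ one_pos hk (right_mem_Icc.2 zero_le_one),
    hu₂.dOn_sub hv₂ one_lt_two hk (left_mem_Icc.2 one_le_two)]
  unfold jumpAtOne
  ring

namespace GeneralConditions

variable {α₁ α₂ α₂' α₃ β₁ β₂ β₂' β₃ δ₁ δ₂ : ℝ} {u₁ u₂ v₁ v₂ : ℝ → ℝ}

theorem jumpAtOne_zero (h : GeneralConditions α₁ α₂ α₃ β₁ β₂ β₃ δ₁ δ₂ u₁ u₂) :
    jumpAtOne 0 u₁ u₂ = δ₁ := by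
  simp [jumpAtOne, h.val₁_left, h.val₁_right]

theorem jumpAtOne_one (h : GeneralConditions α₁ α₂ α₃ β₁ β₂ β₃ δ₁ δ₂ u₁ u₂) :
    jumpAtOne 1 u₁ u₂ = δ₂ := by
  simp [jumpAtOne, h.der₁_left, h.der₁_right]

theorem clampedPair_sub (hu : GeneralConditions α₁ α₂ α₃ β₁ β₂ β₃ δ₁ δ₂ u₁ u₂)
    (hv : GeneralConditions α₁ α₂' α₃ β₁ β₂' β₃ δ₁ δ₂ v₁ v₂)
    (hu₁ : IsStrong4 0 1 u₁) (hu₂ : IsStrong4 1 2 u₂) (hv₁ : IsStrong4 0 1 v₁)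
    (hv₂ : IsStrong4 1 2 v₂) (hjump₂ : jumpAtOne 2 u₁ u₂ = jumpAtOne 2 v₁ v₂)
    (hjump₃ : jumpAtOne 3 u₁ u₂ = jumpAtOne 3 v₁ v₂) : ClampedPair (u₁ - v₁) (u₂ - v₂) where
  reg₁ := hu₁.sub hv₁ one_pos
  reg₂ := hu₂.sub hv₂ one_lt_two
  val₀ := sub_eq_zero.2 (hu.val₀.trans hv.val₀.symm)
  der₀ := by
    rw [hu₁.dOn_sub hv₁ one_pos (by norm_num) (left_mem_Icc.2 zero_le_one), hu.der₀, hv.der₀,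
      sub_self]
  val₂ := sub_eq_zero.2 (hu.val₂.trans hv.val₂.symm)
  der₂ := by
    rw [hu₂.dOn_sub hv₂ one_lt_two (by norm_num) (right_mem_Icc.2 one_le_two), hu.der₂, hv.der₂,
      sub_self]
  jump k hk := by
    rw [jumpAtOne_sub hu₁ hu₂ hv₁ hv₂ hk, sub_eq_zero]
    interval_cases k
    · rw [hu.jumpAtOne_zero, hv.jumpAtOne_zero]
    · rw [hu.jumpAtOne_one, hv.jumpAtOne_one]
    · exact hjump₂
    · exact hjump₃

end GeneralConditions

namespace ClampedPair

variable {b c d w₁ w₂ : ℝ → ℝ} {ε s N m : ℝ}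

theorem energyFlux_zero (h : ClampedPair w₁ w₂) : energyFlux ε 0 1 b w₁ 0 = 0 := by
  simp [energyFlux, h.val₀, h.der₀]

theorem energyFlux_two (h : ClampedPair w₁ w₂) : energyFlux ε 1 2 b w₂ 2 = 0 := by
  simp [energyFlux, h.val₂, h.der₂]

theorem energyFlux_one (h : ClampedPair w₁ w₂) :
    energyFlux ε 1 2 b w₂ 1 = energyFlux ε 0 1 b w₁ 1 := by
  have hval : w₂ 1 = w₁ 1 := sub_eq_zero.1 (h.jump 0 (by norm_num))
  have hder : ∀ k ≤ 3, dOn 1 2 k w₂ 1 = dOn 0 1 k w₁ 1 := fun k hk ↦ sub_eq_zero.1 (h.jump k hk)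
  simp only [energyFlux, hval, hder, Nat.reduceLeDiff, le_refl]

theorem energy_left_le (hw : ClampedPair w₁ w₂) (hcoeff : WeakCoeffAssumptions b c d s)
    (hm : ∀ x ∈ Icc (0 : ℝ) 1, |w₁ x| ≤ m)
    (hop : ∀ᵐ x ∂(volume.restrict (Ioo (0 : ℝ) 1)), |fourthOrderOp ε 0 1 b c w₁ x| ≤ N) :
    energyFlux ε 0 1 b w₁ 1 + energy ε s 0 1 w₁ ≤
      N * m - linftyNorm (Ioo 1 2) d / 2 * ∫ x in (0 : ℝ)..1, w₁ x ^ 2 := by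
  have hsq : ContinuousOn (fun x ↦ linftyNorm (Ioo 1 2) d / 2 * w₁ x ^ 2) (Icc 0 1) :=
    continuousOn_const.mul (hw.reg₁.1.continuousOn.pow 2)
  have hdensity : ∀ᵐ x ∂(volume.restrict (Ioo (0 : ℝ) 1)),
      fourthOrderOp ε 0 1 b c w₁ x * w₁ x ≤ linftyNorm (Ioo 1 2) d / 2 * w₁ x ^ 2 +
        (N * m - linftyNorm (Ioo 1 2) d / 2 * w₁ x ^ 2) := by
    filter_upwards [hop, ae_restrict_mem measurableSet_Ioo] with x hopx hx
    rw [add_sub_cancel]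
    exact mul_le_mul_of_abs_le hopx (hm x (Ioo_subset_Icc_self hx))
  have henergy := hcoeff.energyFlux_sub_add_energy_le hw.reg₁ one_pos le_rfl one_le_two
    (continuousOn_const.sub hsq) hdensity
  simp only [Pi.sub_apply] at henergy
  rw [hw.energyFlux_zero, sub_zero, intervalIntegral.integral_sub intervalIntegrable_const
    (hsq.intervalIntegrable_of_Icc zero_le_one), intervalIntegral.integral_const,
    intervalIntegral.integral_const_mul, sub_zero, one_smul] at henergy
  exact henergy

theorem energy_right_le (hw : ClampedPair w₁ w₂) (hcoeff : WeakCoeffAssumptions b c d s)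
    (hm : ∀ x ∈ Icc (1 : ℝ) 2, |w₂ x| ≤ m)
    (hop : ∀ᵐ x ∂(volume.restrict (Ioo (1 : ℝ) 2)),
      |fourthOrderOp ε 1 2 b c w₂ x + d x * w₁ (x - 1)| ≤ N) :
    -energyFlux ε 0 1 b w₁ 1 + energy ε s 1 2 w₂ ≤
      N * m + linftyNorm (Ioo 1 2) d / 2 * ∫ x in (0 : ℝ)..1, w₁ x ^ 2 := by
  have hsq : ContinuousOn (fun x ↦ linftyNorm (Ioo 1 2) d / 2 * w₁ (x - 1) ^ 2) (Icc 1 2) :=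
    continuousOn_const.mul ((hw.reg₁.1.continuousOn.comp (by fun_prop)
      fun x hx ↦ ⟨by linarith [hx.1], by linarith [hx.2]⟩).pow 2)
  have hdensity : ∀ᵐ x ∂(volume.restrict (Ioo (1 : ℝ) 2)),
      fourthOrderOp ε 1 2 b c w₂ x * w₂ x ≤ linftyNorm (Ioo 1 2) d / 2 * w₂ x ^ 2 +
        (N * m + linftyNorm (Ioo 1 2) d / 2 * w₁ (x - 1) ^ 2) := by
    filter_upwards [hop, (hcoeff.memLinfty_d.mono (Ioo_subset_Ioo_left zero_le_one)).ae_abs_le,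
      ae_restrict_mem measurableSet_Ioo] with x hopx hdx hx
    have hmain := mul_le_mul_of_abs_le hopx (hm x (Ioo_subset_Icc_self hx))
    have hshift := neg_mul_mul_le_half_mul_sq_add_sq (x := w₁ (x - 1)) (y := w₂ x) hdx
    linarith
  have henergy := hcoeff.energyFlux_sub_add_energy_le hw.reg₂ one_lt_two zero_le_one le_rfl
    (continuousOn_const.add hsq) hdensity
  simp only [Pi.add_apply] at henergy
  rw [hw.energyFlux_two, hw.energyFlux_one, zero_sub, intervalIntegral.integral_add
    intervalIntegrable_const (hsq.intervalIntegrable_of_Icc one_le_two),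
    intervalIntegral.integral_const, intervalIntegral.integral_const_mul,
    intervalIntegral.integral_comp_sub_right (fun x ↦ w₁ x ^ 2) 1, sub_self,
    show (2 : ℝ) - 1 = 1 by norm_num, one_smul] at henergy
  exact henergy

theorem energy_add_energy_le (hw : ClampedPair w₁ w₂) (hcoeff : WeakCoeffAssumptions b c d s)
    (hm₁ : ∀ x ∈ Icc (0 : ℝ) 1, |w₁ x| ≤ m) (hm₂ : ∀ x ∈ Icc (1 : ℝ) 2, |w₂ x| ≤ m)
    (hop₁ : ∀ᵐ x ∂(volume.restrict (Ioo (0 : ℝ) 1)), |fourthOrderOp ε 0 1 b c w₁ x| ≤ N)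
    (hop₂ : ∀ᵐ x ∂(volume.restrict (Ioo (1 : ℝ) 2)),
      |fourthOrderOp ε 1 2 b c w₂ x + d x * w₁ (x - 1)| ≤ N) :
    energy ε s 0 1 w₁ + energy ε s 1 2 w₂ ≤ 2 * N * m := by
  linarith [hw.energy_left_le hcoeff hm₁ hop₁, hw.energy_right_le hcoeff hm₂ hop₂]

theorem mul_sq_le_energy_add_energy (hw : ClampedPair w₁ w₂) (hs : 0 ≤ s) :
    (∀ x ∈ Icc (0 : ℝ) 1,
      (s / 2 + ε ^ 2) * w₁ x ^ 2 ≤ energy ε s 0 1 w₁ + energy ε s 1 2 w₂) ∧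
    ∀ x ∈ Icc (1 : ℝ) 2,
      (s / 2 + ε ^ 2) * w₂ x ^ 2 ≤ energy ε s 0 1 w₁ + energy ε s 1 2 w₂ :=
  ⟨fun _ hx ↦ (hw.reg₁.mul_sq_le_energy one_pos (by norm_num) hs (left_mem_Icc.2 zero_le_one)
      hw.val₀ hw.der₀ hx).trans (le_add_of_nonneg_right (energy_nonneg hs one_le_two)),
    fun _ hx ↦ (hw.reg₂.mul_sq_le_energy one_lt_two (by norm_num) hs (right_mem_Icc.2 one_le_two)
      hw.val₂ hw.der₂ hx).trans (le_add_of_nonneg_left (energy_nonneg hs zero_le_one))⟩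

theorem abs_le (hw : ClampedPair w₁ w₂) (hcoeff : WeakCoeffAssumptions b c d s) (hN : 0 ≤ N)
    (hop₁ : ∀ᵐ x ∂(volume.restrict (Ioo (0 : ℝ) 1)), |fourthOrderOp ε 0 1 b c w₁ x| ≤ N)
    (hop₂ : ∀ᵐ x ∂(volume.restrict (Ioo (1 : ℝ) 2)),
      |fourthOrderOp ε 1 2 b c w₂ x + d x * w₁ (x - 1)| ≤ N) :
    (∀ x ∈ Icc (0 : ℝ) 1, |w₁ x| ≤ 2 * N / (s / 2 + ε ^ 2)) ∧
      ∀ x ∈ Icc (1 : ℝ) 2, |w₂ x| ≤ 2 * N / (s / 2 + ε ^ 2) := by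
  obtain ⟨hlow₁, hlow₂⟩ := hw.mul_sq_le_energy_add_energy (ε := ε) hcoeff.pos.le
  have hq : 0 < s / 2 + ε ^ 2 := add_pos_of_pos_of_nonneg (half_pos hcoeff.pos) (sq_nonneg ε)
  set E := energy ε s 0 1 w₁ + energy ε s 1 2 w₂
  have hE₀ : 0 ≤ E :=
    (by positivity : 0 ≤ (s / 2 + ε ^ 2) * w₁ 0 ^ 2).trans (hlow₁ 0 (left_mem_Icc.2 zero_le_one))
  have hroot : ∀ {y : ℝ}, (s / 2 + ε ^ 2) * y ^ 2 ≤ E → |y| ≤ √(E / (s / 2 + ε ^ 2)) :=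
    fun hy ↦ Real.abs_le_sqrt ((le_div_iff₀' hq).2 hy)
  have hself : E ≤ 2 * N * √(E / (s / 2 + ε ^ 2)) :=
    hw.energy_add_energy_le hcoeff (fun x hx ↦ hroot (hlow₁ x hx))
      (fun x hx ↦ hroot (hlow₂ x hx)) hop₁ hop₂
  have hsqrt : √(E / (s / 2 + ε ^ 2)) ≤ 2 * N / (s / 2 + ε ^ 2) := by
    rcases (Real.sqrt_nonneg (E / (s / 2 + ε ^ 2))).eq_or_lt with hzero | hpos
    · rw [← hzero]
      positivity
    · refine le_of_mul_le_mul_right ?_ hpos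
      rw [Real.mul_self_sqrt (by positivity), div_mul_eq_mul_div]
      gcongr
  exact ⟨fun x hx ↦ (hroot (hlow₁ x hx)).trans hsqrt, fun x hx ↦ (hroot (hlow₂ x hx)).trans hsqrt⟩

end ClampedPair

end ClampedPair

section Lift

/-- The polynomial with coefficients `a i` in powers of `x - l`, the form in which the lifts
of the data are written. -/
def taylorPoly {n : ℕ} (l : ℝ) (a : Fin n → ℝ) : ℝ → ℝ :=
  fun x ↦ ∑ i, a i * (x - l) ^ (i : ℕ)

/-- The affine function with value `p₀` and slope `p₁` at `0`. -/
def affineLift (p₀ p₁ : ℝ) : ℝ → ℝ :=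
  taylorPoly 0 ![p₀, p₁]

/-- The quintic with value `p₀` and slope `p₁` at `1`, value `q₀` and slope `q₁` at `2`, and
vanishing second and third derivatives at `1`, so that it continues an affine function on `[0, 1]`
up to jumps of value and slope. -/
def quinticLift (p₀ p₁ q₀ q₁ : ℝ) : ℝ → ℝ :=
  taylorPoly 1 ![p₀, p₁, 0, 0, 5 * (q₀ - p₀ - p₁) - (q₁ - p₁), q₁ - p₁ - 4 * (q₀ - p₀ - p₁)]

section TaylorPoly

variable {n : ℕ} {l r : ℝ} {a : Fin n → ℝ}

theorem isStrong4_taylorPoly (hlr : l < r) {x₀ : ℝ} : IsStrong4 l r (taylorPoly x₀ a) :=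
  isStrong4_of_contDiffOn hlr (by unfold taylorPoly; fun_prop)

open Polynomial in
theorem dOn_polynomial_eval (hlr : l < r) (p : ℝ[X]) (k : ℕ) {x : ℝ} (hx : x ∈ Icc l r) :
    dOn l r k (fun y ↦ p.eval y) x = (derivative^[k] p).eval x := by
  induction k generalizing x with
  | zero => rw [dOn_zero, Function.iterate_zero_apply]
  | succ k ih =>
    rw [dOn_succ, derivWithin_congr (fun y hy ↦ ih hy) (ih hx),
      Polynomial.derivWithin _ (uniqueDiffOn_Icc hlr x hx), Function.iterate_succ_apply']

open Polynomial in
theorem dOn_taylorPoly (hlr : l < r) (k : ℕ) {x x₀ : ℝ} (hx : x ∈ Icc l r) :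
    dOn l r k (taylorPoly x₀ a) x =
      ∑ i, a i * ((i : ℕ).descFactorial k * (x - x₀) ^ (i - k : ℕ)) := by
  have hpoly : taylorPoly x₀ a = fun x ↦ (∑ i, C (a i) * (X - C x₀) ^ (i : ℕ)).eval x := by
    ext x
    simp [taylorPoly, eval_finsetSum]
  rw [hpoly, dOn_polynomial_eval hlr _ k hx, iterate_derivative_sum, eval_finsetSum]
  simp [iterate_derivative_C_mul, iterate_derivative_X_sub_pow]

open scoped Nat in
theorem abs_dOn_taylorPoly_le (hlr : l < r) (hunit : r - l ≤ 1) (k : ℕ) {x : ℝ}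
    (hx : x ∈ Icc l r) : |dOn l r k (taylorPoly l a) x| ≤ ∑ i, |a i| * (i : ℕ)! := by
  rw [dOn_taylorPoly hlr k hx]
  refine (Finset.abs_sum_le_sum_abs _ _).trans (Finset.sum_le_sum fun i _ ↦ ?_)
  have hpow : |(x - l) ^ (i - k : ℕ)| ≤ 1 := by
    rw [abs_pow]
    refine pow_le_one₀ (abs_nonneg _) ?_
    rw [abs_of_nonneg (sub_nonneg.2 hx.1)]
    linarith [hx.2]
  have hfac : ((i : ℕ).descFactorial k : ℝ) ≤ (i : ℕ)! := by
    norm_cast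
    rcases le_or_gt k i with hk | hk
    · exact (Nat.le_mul_of_pos_left _ (Nat.factorial_pos _)).trans_eq
        (Nat.factorial_mul_descFactorial hk)
    · rw [Nat.descFactorial_of_lt hk]
      exact Nat.zero_le _
  rw [abs_mul, abs_mul, Nat.abs_cast]
  gcongr
  exact (mul_le_of_le_one_right (by positivity) hpow).trans hfac

end TaylorPoly

variable {α₁ α₃ β₁ β₃ δ₁ δ₂ p₀ p₁ q₀ q₁ A x : ℝ}

theorem isStrong4_affineLift : IsStrong4 0 1 (affineLift p₀ p₁) := isStrong4_taylorPoly one_pos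

theorem isStrong4_quinticLift : IsStrong4 1 2 (quinticLift p₀ p₁ q₀ q₁) :=
  isStrong4_taylorPoly one_lt_two

theorem generalConditions_lift :
    GeneralConditions α₁ (α₁ + β₁) α₃ β₁ β₁ β₃ δ₁ δ₂ (affineLift α₁ β₁)
      (quinticLift (α₁ + β₁ + δ₁) (β₁ + δ₂) α₃ β₃) where
  val₀ := by simp [affineLift, taylorPoly]
  val₁_left := by simp [affineLift, taylorPoly]
  val₁_right := by simp [quinticLift, taylorPoly, Fin.sum_univ_succ]
  val₂ := by
    simp only [quinticLift, taylorPoly, Fin.sum_univ_six, Matrix.cons_val, Fin.isValue]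
    ring
  der₀ := by simp [affineLift, dOn_taylorPoly]
  der₁_left := by simp [affineLift, dOn_taylorPoly]
  der₁_right := by simp [quinticLift, dOn_taylorPoly, Fin.sum_univ_succ]
  der₂ := by
    rw [quinticLift, dOn_taylorPoly one_lt_two 1 (right_mem_Icc.2 one_le_two)]
    simp only [Fin.sum_univ_six, Matrix.cons_val, Fin.isValue, Nat.descFactorial_one,
      Fin.coe_ofNat_eq_mod]
    push_cast
    ring

theorem jumpAtOne_lift {k : ℕ} (hk : k = 2 ∨ k = 3) :
    jumpAtOne k (affineLift α₁ β₁) (quinticLift p₀ p₁ q₀ q₁) = 0 := by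
  rcases hk with rfl | rfl <;>
    simp [jumpAtOne, affineLift, quinticLift, dOn_taylorPoly, Fin.sum_univ_succ]

theorem abs_dOn_affineLift_le (k : ℕ) (hx : x ∈ Icc (0 : ℝ) 1) :
    |dOn 0 1 k (affineLift p₀ p₁) x| ≤ |p₀| + |p₁| := by
  simpa [affineLift] using abs_dOn_taylorPoly_le (a := ![p₀, p₁]) one_pos (by norm_num) k hx

-- `2090 = 1 + 1 + 17 * 4! + 14 * 5!`, from the coefficient bounds `A`, `A`, `17 * A`, `14 * A`.
theorem abs_dOn_quinticLift_le (h₀ : |p₀| ≤ A) (h₁ : |p₁| ≤ A) (h₂ : |q₀| ≤ A) (h₃ : |q₁| ≤ A)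
    (k : ℕ) (hx : x ∈ Icc (1 : ℝ) 2) : |dOn 1 2 k (quinticLift p₀ p₁ q₀ q₁) x| ≤ 2090 * A := by
  have h₄ : |5 * (q₀ - p₀ - p₁) - (q₁ - p₁)| ≤ 17 * A := by
    rw [abs_le] at *
    constructor <;> linarith
  have h₅ : |q₁ - p₁ - 4 * (q₀ - p₀ - p₁)| ≤ 14 * A := by
    rw [abs_le] at *
    constructor <;> linarith
  refine (abs_dOn_taylorPoly_le one_lt_two (by norm_num) k hx).trans ?_
  simp only [Fin.sum_univ_six, Matrix.cons_val, Fin.isValue, Nat.factorial, abs_zero]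
  push_cast
  linarith

end Lift

section Stability

variable {ε s M : ℝ} {b c d f Φ u₁ u₂ g₁ g₂ : ℝ → ℝ}

/-- The size `‖b‖ + ‖c‖ + ‖d‖` of the coefficients in `L^∞(0, 2)`, in terms of which the
residual of a lift is bounded. -/
noncomputable def coeffSize (b c d : ℝ → ℝ) : ℝ :=
  linftyNorm (Ioo 0 2) b + linftyNorm (Ioo 0 2) c + linftyNorm (Ioo 0 2) d

theorem coeffSize_nonneg : 0 ≤ coeffSize b c d :=
  add_nonneg (add_nonneg linftyNorm_nonneg linftyNorm_nonneg) linftyNorm_nonneg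

namespace WeakCoeffAssumptions

theorem memLinfty_b (h : WeakCoeffAssumptions b c d s) : MemLinfty (Ioo 0 2) b := by
  have hcont := h.absolutelyContinuous_b.continuousOn
  rw [uIcc_of_le zero_le_two] at hcont
  exact (memLinfty_Icc_of_continuousOn hcont).mono Ioo_subset_Icc_self

theorem ae_abs_residual_le {l r : ℝ} {g y : ℝ → ℝ} (h : WeakCoeffAssumptions b c d s)
    (hl : 0 ≤ l) (hr : r ≤ 2) (hf : ∀ᵐ x ∂(volume.restrict (Ioo l r)), |f x| ≤ M)
    (hy : ∀ᵐ x ∂(volume.restrict (Ioo l r)), |y x| ≤ M)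
    (hg : ∀ k ≤ 4, ∀ x ∈ Icc l r, |dOn l r k g x| ≤ M) :
    ∀ᵐ x ∂(volume.restrict (Ioo l r)), |f x - d x * y x - fourthOrderOp ε l r b c g x| ≤
      (1 + ε ^ 2) * ((2 + coeffSize b c d) * M) := by
  have hsub : Ioo l r ⊆ Ioo 0 2 := Ioo_subset_Ioo hl hr
  filter_upwards [hf, hy, ae_restrict_of_ae_restrict_of_subset hsub h.memLinfty_b.ae_abs_le,
    ae_restrict_of_ae_restrict_of_subset hsub h.memLinfty_c.ae_abs_le,
    ae_restrict_of_ae_restrict_of_subset hsub h.memLinfty_d.ae_abs_le,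
    ae_restrict_mem measurableSet_Ioo] with x hfx hyx hbx hcx hdx hx
  have hM : 0 ≤ M := (abs_nonneg _).trans hfx
  have hop := abs_fourthOrderOp_le (ε := ε) hbx hcx fun k hk ↦ hg k hk x (Ioo_subset_Icc_self hx)
  have hdy : |d x * y x| ≤ linftyNorm (Ioo 0 2) d * M := by
    rw [abs_mul]
    exact mul_le_mul hdx hyx (abs_nonneg _) linftyNorm_nonneg
  have hweight : M + linftyNorm (Ioo 0 2) d * M ≤
      (1 + ε ^ 2) * (M + linftyNorm (Ioo 0 2) d * M) :=
    le_mul_of_one_le_left (add_nonneg hM (mul_nonneg linftyNorm_nonneg hM))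
      (le_add_of_nonneg_right (sq_nonneg ε))
  calc |f x - d x * y x - fourthOrderOp ε l r b c g x|
      ≤ |f x| + |d x * y x| + |fourthOrderOp ε l r b c g x| :=
        (abs_sub _ _).trans (add_le_add_left (abs_sub _ _) _)
    _ ≤ (1 + ε ^ 2) * ((2 + coeffSize b c d) * M) := by
      unfold coeffSize
      linarith

end WeakCoeffAssumptions

theorem one_add_sq_div_le (hs : 0 < s) : (1 + ε ^ 2) / (s / 2 + ε ^ 2) ≤ 1 + 2 / s := by
  rw [div_le_iff₀ (by positivity)]
  have hexpand : (1 + 2 / s) * (s / 2 + ε ^ 2) = 1 + ε ^ 2 + (s / 2 + 2 / s * ε ^ 2) := by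
    field_simp
    ring
  rw [hexpand]
  exact le_add_of_nonneg_right (by positivity)

theorem abs_le_add_of_abs_sub_le {x y δ m : ℝ} (hxy : |x - y| ≤ δ) (hy : |y| ≤ m) :
    |x| ≤ δ + m := by
  simpa using (abs_add_le (x - y) y).trans (add_le_add hxy hy)

/-- The constant of the stability estimate `SplitSystem.abs_sub_le`, an upper bound, uniform in
`ε`, for `2 (1 + ε²) (2 + ‖b‖ + ‖c‖ + ‖d‖) / (s / 2 + ε²)`. -/
noncomputable def stabilityConst (b c d : ℝ → ℝ) (s : ℝ) : ℝ :=
  2 * ((1 + 2 / s) * (2 + coeffSize b c d))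

theorem stabilityConst_nonneg (hs : 0 ≤ s) : 0 ≤ stabilityConst b c d s := by
  have := coeffSize_nonneg (b := b) (c := c) (d := d)
  unfold stabilityConst
  positivity

namespace SplitSystem

theorem ae_abs_fourthOrderOp_left_sub_le (h : SplitSystem ε b c d f Φ u₁ u₂)
    (hcoeff : WeakCoeffAssumptions b c d s) (hg₁ : IsStrong4 0 1 g₁)
    (hf : ∀ᵐ x ∂(volume.restrict (Ioo (0 : ℝ) 2)), |f x| ≤ M)
    (hΦ : ∀ᵐ x ∂(volume.restrict (Ioo (-1 : ℝ) 0)), |Φ x| ≤ M)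
    (hM₁ : ∀ k ≤ 4, ∀ x ∈ Icc (0 : ℝ) 1, |dOn 0 1 k g₁ x| ≤ M) :
    ∀ᵐ x ∂(volume.restrict (Ioo (0 : ℝ) 1)),
      |fourthOrderOp ε 0 1 b c (u₁ - g₁) x| ≤ (1 + ε ^ 2) * ((2 + coeffSize b c d) * M) := by
  have hΦ' : ∀ᵐ x ∂(volume.restrict (Ioo (0 : ℝ) 1)), |Φ (x - 1)| ≤ M := by
    simpa using ae_restrict_Ioo_comp_sub_right 1 hΦ
  filter_upwards [h.reg₁.ae_fourthOrderOp_sub c hg₁ one_pos, h.eq₁,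
    hcoeff.ae_abs_residual_le le_rfl one_le_two (ae_restrict_of_ae_restrict_of_subset
      (Ioo_subset_Ioo_right one_le_two) hf) hΦ' hM₁] with x hsub heq hres
  rwa [hsub, show fourthOrderOp ε 0 1 b c u₁ x = f x - d x * Φ (x - 1) from heq]

theorem ae_abs_fourthOrderOp_right_sub_add_le (h : SplitSystem ε b c d f Φ u₁ u₂)
    (hcoeff : WeakCoeffAssumptions b c d s) (hg₂ : IsStrong4 1 2 g₂)
    (hf : ∀ᵐ x ∂(volume.restrict (Ioo (0 : ℝ) 2)), |f x| ≤ M)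
    (hg₁ : ∀ x ∈ Icc (0 : ℝ) 1, |g₁ x| ≤ M)
    (hM₂ : ∀ k ≤ 4, ∀ x ∈ Icc (1 : ℝ) 2, |dOn 1 2 k g₂ x| ≤ M) :
    ∀ᵐ x ∂(volume.restrict (Ioo (1 : ℝ) 2)),
      |fourthOrderOp ε 1 2 b c (u₂ - g₂) x + d x * (u₁ - g₁) (x - 1)| ≤
        (1 + ε ^ 2) * ((2 + coeffSize b c d) * M) := by
  have hg₁' : ∀ᵐ x ∂(volume.restrict (Ioo (1 : ℝ) 2)), |g₁ (x - 1)| ≤ M := by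
    filter_upwards [ae_restrict_mem measurableSet_Ioo] with x hx
    exact hg₁ (x - 1) ⟨by linarith [hx.1], by linarith [hx.2]⟩
  filter_upwards [h.reg₂.ae_fourthOrderOp_sub c hg₂ one_lt_two, h.eq₂,
    hcoeff.ae_abs_residual_le zero_le_one le_rfl (ae_restrict_of_ae_restrict_of_subset
      (Ioo_subset_Ioo_left zero_le_one) hf) hg₁' hM₂] with x hsub heq hres
  rw [hsub, show fourthOrderOp ε 1 2 b c u₂ x = f x - d x * u₁ (x - 1) from heq]
  convert! hres using 2
  simp only [Pi.sub_apply]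
  ring

theorem abs_sub_le (h : SplitSystem ε b c d f Φ u₁ u₂) (hcoeff : WeakCoeffAssumptions b c d s)
    (hg₁ : IsStrong4 0 1 g₁) (hg₂ : IsStrong4 1 2 g₂) (hw : ClampedPair (u₁ - g₁) (u₂ - g₂))
    (hf : ∀ᵐ x ∂(volume.restrict (Ioo (0 : ℝ) 2)), |f x| ≤ M)
    (hΦ : ∀ᵐ x ∂(volume.restrict (Ioo (-1 : ℝ) 0)), |Φ x| ≤ M)
    (hM₁ : ∀ k ≤ 4, ∀ x ∈ Icc (0 : ℝ) 1, |dOn 0 1 k g₁ x| ≤ M)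
    (hM₂ : ∀ k ≤ 4, ∀ x ∈ Icc (1 : ℝ) 2, |dOn 1 2 k g₂ x| ≤ M) :
    (∀ x ∈ Icc (0 : ℝ) 1, |u₁ x - g₁ x| ≤ stabilityConst b c d s * M) ∧
      ∀ x ∈ Icc (1 : ℝ) 2, |u₂ x - g₂ x| ≤ stabilityConst b c d s * M := by
  have hM : 0 ≤ M := (abs_nonneg _).trans (hM₁ 0 (by norm_num) 0 (left_mem_Icc.2 zero_le_one))
  have hsize : 0 ≤ (2 + coeffSize b c d) * M :=
    mul_nonneg (add_nonneg zero_le_two coeffSize_nonneg) hM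
  have huniform : 2 * ((1 + ε ^ 2) * ((2 + coeffSize b c d) * M)) / (s / 2 + ε ^ 2) ≤
      stabilityConst b c d s * M :=
    calc _ = 2 * ((1 + ε ^ 2) / (s / 2 + ε ^ 2) * ((2 + coeffSize b c d) * M)) := by ring
      _ ≤ 2 * ((1 + 2 / s) * ((2 + coeffSize b c d) * M)) := by
        gcongr
        exact one_add_sq_div_le hcoeff.pos
      _ = stabilityConst b c d s * M := by
        unfold stabilityConst
        ring
  obtain ⟨h₁, h₂⟩ := hw.abs_le hcoeff (mul_nonneg (by positivity) hsize)
    (h.ae_abs_fourthOrderOp_left_sub_le hcoeff hg₁ hf hΦ hM₁)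
    (h.ae_abs_fourthOrderOp_right_sub_add_le hcoeff hg₂ hf (hM₁ 0 (by norm_num)) hM₂)
  exact ⟨fun x hx ↦ (h₁ x hx).trans huniform, fun x hx ↦ (h₂ x hx).trans huniform⟩

theorem abs_le {α₁ α₂ α₃ β₁ β₂ β₃ δ₁ δ₂ A : ℝ} (h : SplitSystem ε b c d f Φ u₁ u₂)
    (hcoeff : WeakCoeffAssumptions b c d s)
    (hbc : GeneralConditions α₁ α₂ α₃ β₁ β₂ β₃ δ₁ δ₂ u₁ u₂) (hj₂ : jumpAtOne 2 u₁ u₂ = 0)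
    (hj₃ : jumpAtOne 3 u₁ u₂ = 0) (hf : MemLinfty (Ioo 0 2) f) (hΦ : MemLinfty (Ioo (-1) 0) Φ)
    (hA : linftyNorm (Ioo 0 2) f + linftyNorm (Ioo (-1) 0) Φ
      + |α₁| + |α₃| + |δ₁| + |δ₂| + |β₁| + |β₃| ≤ A) :
    (∀ x ∈ Icc (0 : ℝ) 1, |u₁ x| ≤ (stabilityConst b c d s + 1) * (2090 * A)) ∧
      ∀ x ∈ Icc (1 : ℝ) 2, |u₂ x| ≤ (stabilityConst b c d s + 1) * (2090 * A) := by
  have hf₀ := linftyNorm_nonneg (D := Ioo 0 2) (g := f)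
  have hΦ₀ := linftyNorm_nonneg (D := Ioo (-1) 0) (g := Φ)
  have hα₁ := abs_nonneg α₁
  have hα₃ := abs_nonneg α₃
  have hδ₁ := abs_nonneg δ₁
  have hδ₂ := abs_nonneg δ₂
  have hβ₁ := abs_nonneg β₁
  have hβ₃ := abs_nonneg β₃
  have hM₁ : ∀ k ≤ 4, ∀ x ∈ Icc (0 : ℝ) 1, |dOn 0 1 k (affineLift α₁ β₁) x| ≤ 2090 * A :=
    fun k _ x hx ↦ (abs_dOn_affineLift_le k hx).trans (by linarith)
  have hM₂ : ∀ k ≤ 4, ∀ x ∈ Icc (1 : ℝ) 2,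
      |dOn 1 2 k (quinticLift (α₁ + β₁ + δ₁) (β₁ + δ₂) α₃ β₃) x| ≤ 2090 * A :=
    fun k _ x hx ↦ abs_dOn_quinticLift_le ((abs_add_three _ _ _).trans (by linarith))
      ((abs_add_le _ _).trans (by linarith)) (by linarith) (by linarith) k hx
  have hw := hbc.clampedPair_sub generalConditions_lift h.reg₁ h.reg₂ isStrong4_affineLift
    isStrong4_quinticLift (hj₂.trans (jumpAtOne_lift (.inl rfl)).symm)
    (hj₃.trans (jumpAtOne_lift (.inr rfl)).symm)
  obtain ⟨h₁, h₂⟩ := h.abs_sub_le hcoeff isStrong4_affineLift isStrong4_quinticLift hw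
    (hf.ae_abs_le.mono fun x hx ↦ by linarith) (hΦ.ae_abs_le.mono fun x hx ↦ by linarith) hM₁ hM₂
  rw [add_one_mul]
  exact ⟨fun x hx ↦ abs_le_add_of_abs_sub_le (h₁ x hx) (hM₁ 0 (by norm_num) x hx),
    fun x hx ↦ abs_le_add_of_abs_sub_le (h₂ x hx) (hM₂ 0 (by norm_num) x hx)⟩

end SplitSystem

end Stability

theorem lemma1_general (b c d : ℝ → ℝ) (s : ℝ) (hcoeff : WeakCoeffAssumptions b c d s) :
    ∃ C : ℝ, 0 < C ∧
      ∀ (ε : ℝ) (f Φ : ℝ → ℝ)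
        (_ : MemLinfty (Ioo 0 2) f) (_ : MemLinfty (Ioo (-1) 0) Φ)
        (α₁ α₂ α₃ β₁ β₂ β₃ δ₁ δ₂ : ℝ) (u₁ u₂ : ℝ → ℝ)
        (_ : SplitSystem ε b c d f Φ u₁ u₂)
        (_ : GeneralConditions α₁ α₂ α₃ β₁ β₂ β₃ δ₁ δ₂ u₁ u₂)
        (_ : jumpAtOne 2 u₁ u₂ = 0) (_ : jumpAtOne 3 u₁ u₂ = 0),
        MemLinfty (Ioo 0 2) (glue u₁ u₂) ∧
        linftyNorm (Ioo 0 2) (glue u₁ u₂) ≤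
          C * (linftyNorm (Ioo 0 2) f + linftyNorm (Ioo (-1) 0) Φ
            + |α₁| + |α₃| + |δ₁| + |δ₂| + |β₁| + |β₃|) := by
  have hC := stabilityConst_nonneg (b := b) (c := c) (d := d) hcoeff.pos.le
  refine ⟨(stabilityConst b c d s + 1) * 2090, by positivity, ?_⟩
  intro ε f Φ hf hΦ α₁ α₂ α₃ β₁ β₂ β₃ δ₁ δ₂ u₁ u₂ hsys hbc hj₂ hj₃
  obtain ⟨h₁, h₂⟩ := hsys.abs_le hcoeff hbc hj₂ hj₃ hf hΦ le_rfl
  refine ⟨memLinfty_glue hsys.reg₁.1.continuousOn hsys.reg₂.1.continuousOn, ?_⟩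
  rw [mul_assoc]
  exact linftyNorm_le_of_bound measurableSet_Ioo
    ((abs_nonneg _).trans (h₁ 0 (left_mem_Icc.2 zero_le_one)))
    fun x hx ↦ abs_glue_le h₁ h₂ (Ioo_subset_Icc_self hx)

theorem lemma1 (b c d : ℝ → ℝ) (β γ : ℝ) (hcoeff : CoeffAssumptions b c d β γ) :
    ∃ C : ℝ, 0 < C ∧
      ∀ (ε : ℝ) (_ : 0 < ε) (f Φ : ℝ → ℝ)
        (_ : MemLinfty (Ioo 0 2) f) (_ : MemLinfty (Ioo (-1) 0) Φ)
        (α₁ α₂ α₃ β₁ β₂ β₃ δ₁ δ₂ : ℝ) (u₁ u₂ : ℝ → ℝ)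
        (_ : SplitSystem ε b c d f Φ u₁ u₂)
        (_ : GeneralConditions α₁ α₂ α₃ β₁ β₂ β₃ δ₁ δ₂ u₁ u₂)
        (_ : jumpAtOne 2 u₁ u₂ = 0) (_ : jumpAtOne 3 u₁ u₂ = 0),
        MemLinfty (Ioo 0 2) (glue u₁ u₂) ∧
        linftyNorm (Ioo 0 2) (glue u₁ u₂) ≤
          C * (linftyNorm (Ioo 0 2) f + linftyNorm (Ioo (-1) 0) Φ
            + |α₁| + |α₃| + |δ₁| + |δ₂| + |β₁| + |β₃|) :=
  let ⟨C, hC, h⟩ := lemma1_general b c d (β ^ 2) hcoeff.weak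
  ⟨C, hC, fun ε _ ↦ h ε⟩
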